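/- Let $n,m,k$ be nonnegative integers and let $\widehat{\mathbb S}^n$ be the space of real symmetric matrices with rows and columns indexed by $\{0\}\cup[n]$, with the trace inner product $\langle X,Y\rangle=\operatorname{tr}(XY^{\mathsf T})$. Let $\mathcal A\colon\widehat{\mathbb S}^n\to\mathbb R^m$ and $\mathcal L\colon\mathbb R^k\to\widehat{\mathbb S}^n$ be linear maps with adjoints $\mathcal A^*,\mathcal L^*$, and let $b\in\mathbb R^m$. The system $\mathcal A(\widehat X)\le b$, $\widehat X\succeq0$ is called totally dual integral (TDI) through $\mathcal L$ if, for every $c\in\mathbb Z^k$, the following holds: whenever the dual SDP $$\inf\{\,b^{\mathsf T}y : y\in\mathbb R^m_+,\ \widehat S=\mathcal A^*(y)-\mathcal L(c)\succeq 0\,\}$$ of $\sup\{\langle\mathcal L(c),\widehat X\rangle:\mathcal A(\widehat X)\le b,\ \widehat X\succeq0\}$ has an optimal solution, it has an optimal solution $(y,\widehat S)$ that is integral, i.e., $y\in\mathbb Z^m_+$ and $$\widehat S=\sum_{U\subseteq[n]}\mu_U\begin{bmatrix}-1\\ \mathbb 1_U\end{bmatrix}\begin{bmatrix}-1\\ \mathbb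 1_U\end{bmatrix}^{\mathsf T}\quad\text{for some nonnegative integers }\mu_U\ (U\subseteq[n]),$$ where $\mathbb 1_U\in\{0,1\}^n$ is the incidence vector of $U$. Theorem. Suppose that the system $\mathcal A(\widehat X)\le b$, $\widehat X\succeq 0$ is TDI through $\mathcal L$. Put $\widehat{\mathscr C}=\{\widehat X\in\widehat{\mathbb S}^n:\widehat X\succeq0,\ \mathcal A(\widehat X)\le b\}$ and $\mathscr C=\mathcal L^*(\widehat{\mathscr C})\subseteq\mathbb R^k$. If $b$ is integral, $\mathscr C$ is compact, and $\widehat{\mathscr C}$ contains a positive definite matrix, then $\mathscr C=\mathscr C_I$, where $\mathscr C_I=\operatorname{conv}(\mathscr C\cap\mathbb Z^k)$ is the integer hull of $\mathscr C$. -/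

import Mathlib

open scoped Matrix Matrix.Norms.Frobenius

/-- The trace inner product `⟨X, Y⟩ = tr (X Yᵀ)` on real square matrices; the norm that it induces
is the Frobenius norm. -/
noncomputable instance Matrix.traceInnerProductSpace (d : ℕ) :
    InnerProductSpace ℝ (Matrix (Fin d) (Fin d) ℝ) where
  inner X Y := (X * Yᵀ).trace
  norm_sq_eq_re_inner X := by
    rw [Matrix.frobenius_norm_def, ← Real.sqrt_eq_rpow, Real.sq_sqrt (by positivity)]
    simp [Matrix.trace, Matrix.mul_apply, ← pow_two]
  conj_inner_symm X Y := by
    rw [← Matrix.trace_transpose (Y * Xᵀ)]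
    simp
  add_left X Y Z := by simp [add_mul]
  smul_left X Y r := by simp

namespace SemidefTDI

/-- The space of real symmetric matrices indexed by `{0} ∪ [n]`. The index `0 : Fin (n + 1)` is the
extra index, and `i.succ` stands for the element `i` of the ground set. It carries the trace inner
product, as a subspace of the space of all matrices. -/
def symHat (n : ℕ) : Submodule ℝ (Matrix (Fin (n + 1)) (Fin (n + 1)) ℝ) where
  carrier := {X | X.IsSymm}
  add_mem' hX hY := hX.add hY
  zero_mem' := Matrix.isSymm_zero
  smul_mem' r _ hX := hX.smul r

variable {n m k : ℕ}

/-- A real vector with integer entries. -/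
def IsIntegralVec {d : ℕ} (x : EuclideanSpace ℝ (Fin d)) : Prop :=
  ∀ i, ∃ z : ℤ, x i = z

/-- The integer hull: the convex hull of the integer points of a set. -/
def integerHull {d : ℕ} (C : Set (EuclideanSpace ℝ (Fin d))) : Set (EuclideanSpace ℝ (Fin d)) :=
  convexHull ℝ {x | x ∈ C ∧ IsIntegralVec x}

/-- The feasible set of the system `𝒜(X) ≤ b`, `X ⪰ 0`. -/
def feasibleSet (𝒜 : symHat n →ₗ[ℝ] EuclideanSpace ℝ (Fin m)) (b : EuclideanSpace ℝ (Fin m)) :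
    Set (symHat n) :=
  {X | (X : Matrix (Fin (n + 1)) (Fin (n + 1)) ℝ).PosSemidef ∧ ∀ i, 𝒜 X i ≤ b i}

/-- The dual slack matrix `𝒜*(y) - C`. -/
noncomputable def dualSlack (𝒜 : symHat n →ₗ[ℝ] EuclideanSpace ℝ (Fin m)) (C : symHat n)
    (y : EuclideanSpace ℝ (Fin m)) : symHat n :=
  LinearMap.adjoint 𝒜 y - C

/-- Feasibility in the dual SDP
`inf {⟨b, y⟩ : y ≥ 0, 𝒜*(y) - C ⪰ 0}` of `sup {⟨C, X⟩ : 𝒜(X) ≤ b, X ⪰ 0}`. -/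
def IsDualFeasible (𝒜 : symHat n →ₗ[ℝ] EuclideanSpace ℝ (Fin m)) (C : symHat n)
    (y : EuclideanSpace ℝ (Fin m)) : Prop :=
  (∀ i, 0 ≤ y i) ∧
    (dualSlack 𝒜 C y : Matrix (Fin (n + 1)) (Fin (n + 1)) ℝ).PosSemidef

/-- Optimality in the dual SDP. -/
def IsDualOptimal (𝒜 : symHat n →ₗ[ℝ] EuclideanSpace ℝ (Fin m)) (b : EuclideanSpace ℝ (Fin m))
    (C : symHat n) (y : EuclideanSpace ℝ (Fin m)) : Prop :=
  IsDualFeasible 𝒜 C y ∧ ∀ z, IsDualFeasible 𝒜 C z → inner ℝ b y ≤ inner ℝ b z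

/-- The vector `(-1, 𝟙_A)`, where `𝟙_A` is the incidence vector of `A ⊆ [n]`. -/
def signedIncidence (A : Finset (Fin n)) : Fin (n + 1) → ℝ :=
  Fin.cons (-1) fun i => if i ∈ A then 1 else 0

/-- Integrality of a dual slack: `S = ∑_A μ_A (-1, 𝟙_A)(-1, 𝟙_A)ᵀ`, the sum being over the
subsets `A` of `[n]`, for some nonnegative integers `μ_A`. -/
def IsIntegralSlack (S : symHat n) : Prop :=
  ∃ μ : Finset (Fin n) → ℕ,
    (S : Matrix (Fin (n + 1)) (Fin (n + 1)) ℝ) =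
      ∑ A, (μ A : ℝ) • Matrix.vecMulVec (signedIncidence A) (signedIncidence A)

/-- The system `𝒜(X) ≤ b`, `X ⪰ 0` is totally dual integral through `ℒ`: for each integer vector
`c`, the dual of `sup {⟨ℒ(c), X⟩ : 𝒜(X) ≤ b, X ⪰ 0}` has an integral optimal solution (an integer
vector `y` with integral slack) whenever it has an optimal solution. -/
def IsTDIThrough (𝒜 : symHat n →ₗ[ℝ] EuclideanSpace ℝ (Fin m)) (b : EuclideanSpace ℝ (Fin m))
    (ℒ : EuclideanSpace ℝ (Fin k) →ₗ[ℝ] symHat n) : Prop :=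
  ∀ c : EuclideanSpace ℝ (Fin k), IsIntegralVec c →
    (∃ y, IsDualOptimal 𝒜 b (ℒ c) y) →
    ∃ y, IsDualOptimal 𝒜 b (ℒ c) y ∧ IsIntegralVec y ∧ IsIntegralSlack (dualSlack 𝒜 (ℒ c) y)

end SemidefTDI

/-! Let `σ` be the support function of the compact convex set `𝒞 = ℒ*(feasibleSet)`. For integral
`c`, the positive definite feasible point gives strong duality with an attained dual optimum
(`exists_isDualFeasible_inner_le`). TDI then supplies an integral optimal `y`, so `σ c = ⟨b, y⟩` is
an integer.

An integer-valued support function on integer vectors forces integrality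
(`subset_integerHull_of_isCompact`). Being Lipschitz, `σ` is differentiable almost everywhere, and
its gradient there is a maximizer in `𝒞`. Comparing `σ` at neighbouring lattice points far out along
the ray of `c` shows that this gradient is integral (`isIntegralVec_of_hasFDerivAt`). If a point of
`𝒞` lay outside the integer hull, the directions strictly separating it from the integer points
would form a nonempty open set. That set would contain a point of differentiability, whose integral
maximizer contradicts the separation. -/

namespace SemidefTDI

/-! ### Farkas' lemma -/

/-- **Farkas' lemma** for finitely many linear functionals. -/
theorem exists_nonneg_combination_of_forall_nonneg {V ι : Type*} [AddCommGroup V] [Module ℝ V]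
    (s : Finset ι) (a : ι → V →ₗ[ℝ] ℝ) (g : V →ₗ[ℝ] ℝ)
    (h : ∀ x, (∀ i ∈ s, 0 ≤ a i x) → 0 ≤ g x) :
    ∃ y : ι → ℝ, (∀ i, 0 ≤ y i) ∧ g = ∑ i ∈ s, y i • a i := by
  classical
  induction s using Finset.induction_on generalizing a g with
  | empty =>
    refine ⟨0, fun _ => le_rfl, LinearMap.ext fun x => ?_⟩
    have h1 := h x (by simp)
    have h2 := h (-x) (by simp)
    rw [map_neg] at h2
    simpa using le_antisymm (by linarith) h1
  | insert j s hj ih =>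
    by_cases hs : ∀ x, (∀ i ∈ s, 0 ≤ a i x) → 0 ≤ g x
    · obtain ⟨y, hy, hg⟩ := ih a g hs
      refine ⟨Function.update y j 0, fun i => ?_, ?_⟩
      · by_cases hij : i = j
        · subst hij; simp
        · simp [hij, hy i]
      · rw [Finset.sum_insert hj, hg]
        simp only [Function.update_self, zero_smul, zero_add]
        refine Finset.sum_congr rfl fun i hi => ?_
        rw [Function.update_of_ne (ne_of_mem_of_not_mem hi hj)]
    · push Not at hs
      obtain ⟨u, hu, hgu⟩ := hs
      have hju : a j u < 0 := by
        by_contra hcon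
        refine absurd (h u fun i hi => ?_) (not_le.2 hgu)
        rcases Finset.mem_insert.1 hi with rfl | hi
        · exact not_lt.1 hcon
        · exact hu i hi
      obtain ⟨w, hw, hgw, hjw⟩ : ∃ w, (∀ i ∈ s, 0 ≤ a i w) ∧ g w < 0 ∧ a j w = -1 := by
        have hpos : 0 < (-(a j u))⁻¹ := inv_pos.2 (by linarith)
        refine ⟨(-(a j u))⁻¹ • u, fun i hi => ?_, ?_, ?_⟩
        · simpa only [map_smul, smul_eq_mul] using mul_nonneg hpos.le (hu i hi)
        · simpa only [map_smul, smul_eq_mul] using mul_neg_of_pos_of_neg hpos hgu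
        · rw [map_smul, smul_eq_mul, inv_neg, neg_mul, inv_mul_cancel₀ hju.ne]
      -- Project along `w` onto the kernel of `a j`: the new functionals are the old ones evaluated
      -- at `x + a j x • w`, where `a j` vanishes. Expanding the result, `a j` gets the coefficient
      -- `∑ y i * a i w - g w`, nonnegative because `g w < 0`.
      obtain ⟨y, hy, hg⟩ := ih (fun i => a i + a i w • a j) (g + g w • a j) fun x hx => by
        have := h (x + a j x • w) fun i hi => by
          rcases Finset.mem_insert.1 hi with rfl | hi
          · simp [hjw]
          · have := hx i hi
            simp only [LinearMap.add_apply, LinearMap.smul_apply, smul_eq_mul] at this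
            simp only [map_add, map_smul, smul_eq_mul]
            linarith
        simp only [map_add, map_smul, smul_eq_mul] at this
        simp only [LinearMap.add_apply, LinearMap.smul_apply, smul_eq_mul]
        linarith
      have hnn : 0 ≤ ∑ i ∈ s, y i * a i w - g w := by
        have := Finset.sum_nonneg fun i hi => mul_nonneg (hy i) (hw i hi)
        linarith
      refine ⟨Function.update y j (∑ i ∈ s, y i * a i w - g w), fun i => ?_, ?_⟩
      · by_cases hij : i = j
        · subst hij; simpa using hnn
        · simp [hij, hy i]
      · rw [Finset.sum_insert hj]
        have hsum : ∑ i ∈ s, Function.update y j (∑ i ∈ s, y i * a i w - g w) i • a i =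
            ∑ i ∈ s, y i • a i :=
          Finset.sum_congr rfl fun i hi => by
            rw [Function.update_of_ne (ne_of_mem_of_not_mem hi hj)]
        rw [hsum, Function.update_self]
        refine LinearMap.ext fun x => ?_
        have hx := LinearMap.congr_fun hg x
        simp only [LinearMap.add_apply, LinearMap.smul_apply, smul_eq_mul, LinearMap.sum_apply,
          mul_add, Finset.sum_add_distrib, ← mul_assoc, ← Finset.sum_mul] at hx ⊢
        linarith

/-- The affine form of **Farkas' lemma**: a linear functional bounded by `p` on a nonempty
polyhedron is a nonnegative combination of its constraints, with right-hand side at most `p`. -/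
theorem exists_nonneg_combination_of_forall_le {V ι : Type*} [AddCommGroup V] [Module ℝ V]
    [Fintype ι] (a : ι → V →ₗ[ℝ] ℝ) (b : ι → ℝ) (g : V →ₗ[ℝ] ℝ) (p : ℝ)
    (hne : ∃ x, ∀ i, a i x ≤ b i) (h : ∀ x, (∀ i, a i x ≤ b i) → g x ≤ p) :
    ∃ y : ι → ℝ, (∀ i, 0 ≤ y i) ∧ g = ∑ i, y i • a i ∧ ∑ i, y i * b i ≤ p := by
  -- Homogenize with a variable `t ≥ 0`, indexed by `none`; its multiplier is the slack `p - ∑ y i *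
  -- b i`.
  obtain ⟨y, hy, hg⟩ := exists_nonneg_combination_of_forall_nonneg (V := V × ℝ)
    (Finset.univ : Finset (Option ι))
    (fun o => o.elim (LinearMap.snd ℝ V ℝ)
      fun i => b i • LinearMap.snd ℝ V ℝ - a i ∘ₗ LinearMap.fst ℝ V ℝ)
    (p • LinearMap.snd ℝ V ℝ - g ∘ₗ LinearMap.fst ℝ V ℝ) fun ⟨x, t⟩ hx => by
      have ht : 0 ≤ t := by simpa using hx none (Finset.mem_univ _)
      have hx' : ∀ i, a i x ≤ b i * t := fun i => by
        simpa using hx (some i) (Finset.mem_univ _)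
      suffices g x ≤ p * t by simpa using this
      rcases ht.eq_or_lt with rfl | ht
      · obtain ⟨z, hz⟩ := hne
        by_contra hcon
        rw [mul_zero, not_le] at hcon
        -- At `t = 0`, `x` is a recession direction; this step length would push `g` above `p`.
        have hr : 0 ≤ (|p - g z| + 1) / g x := by positivity
        have := h (z + ((|p - g z| + 1) / g x) • x) fun i => by
          have hi := hx' i
          rw [mul_zero] at hi
          have := mul_nonpos_of_nonneg_of_nonpos hr hi
          simp only [map_add, map_smul, smul_eq_mul]
          linarith [hz i]
        simp only [map_add, map_smul, smul_eq_mul, div_mul_cancel₀ _ hcon.ne'] at this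
        linarith [le_abs_self (p - g z)]
      · have := h (t⁻¹ • x) fun i => by
          rw [map_smul, smul_eq_mul, inv_mul_le_iff₀ ht]
          linarith [hx' i]
        rw [map_smul, smul_eq_mul, inv_mul_le_iff₀ ht] at this
        linarith
  refine ⟨fun i => y (some i), fun i => hy _, LinearMap.ext fun x => ?_, ?_⟩
  · have := LinearMap.congr_fun hg (x, 0)
    simp only [Fintype.sum_option] at this
    simpa using this
  · have := LinearMap.congr_fun hg (0, 1)
    simp only [Fintype.sum_option] at this
    simp at this
    linarith [hy none]

/-! ### Support functions and integrality -/

theorem finite_setOf_isIntegralVec {d : ℕ} {C : Set (EuclideanSpace ℝ (Fin d))}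
    (hC : Bornology.IsBounded C) : {x | x ∈ C ∧ IsIntegralVec x}.Finite := by
  obtain ⟨R, hR⟩ := hC.exists_norm_le
  refine ((Set.Finite.pi' fun _ : Fin d => Set.finite_Icc (-⌈R⌉) ⌈R⌉).image
    fun z : Fin d → ℤ => WithLp.toLp 2 fun i => (z i : ℝ)).subset ?_
  rintro x ⟨hxC, hx⟩
  choose z hz using hx
  refine ⟨z, fun i => ?_, ?_⟩
  · have h1 : |(z i : ℝ)| ≤ ⌈R⌉ := by
      rw [← hz i, ← Real.norm_eq_abs]
      exact (PiLp.norm_apply_le x i).trans ((hR x hxC).trans (Int.le_ceil R))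
    exact abs_le.1 (by exact_mod_cast h1)
  · ext i
    exact (hz i).symm

theorem exists_eq_intCast_of_forall_exists_abs_sub_lt {r : ℝ}
    (h : ∀ ε > 0, ∃ z : ℤ, |r - z| < ε) : ∃ z : ℤ, r = z := by
  have : r ∈ closure (Set.range ((↑) : ℤ → ℝ)) :=
    Metric.mem_closure_range_iff.2 fun ε hε => by simpa [Real.dist_eq] using h ε hε
  rw [Int.isClosedEmbedding_coe_real.isClosed_range.closure_eq] at this
  obtain ⟨z, hz⟩ := this
  exact ⟨z, hz.symm⟩

open scoped RealInnerProductSpace in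
/-- If a function `σ` that is positively homogeneous and takes integer values at integer vectors
is differentiable at `c`, then its gradient at `c` is an integer vector. -/
theorem isIntegralVec_of_hasFDerivAt {d : ℕ} {σ : EuclideanSpace ℝ (Fin d) → ℝ}
    (hhom : ∀ t : ℝ, 0 ≤ t → ∀ c, σ (t • c) = t * σ c)
    (hint : ∀ c, IsIntegralVec c → ∃ z : ℤ, σ c = z)
    {c x : EuclideanSpace ℝ (Fin d)} (hx : HasFDerivAt σ (innerSL ℝ x) c) :
    IsIntegralVec x := by
  -- Euler's identity: differentiate `t ↦ σ (t • c)` at `t = 1` in two ways.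
  have hc : σ c = ⟪x, c⟫ := by
    have hline : HasDerivAt (fun t : ℝ => t • c) c 1 := by
      simpa using (hasDerivAt_id (1 : ℝ)).smul_const c
    have h1 : HasDerivAt (fun t : ℝ => σ (t • c)) ⟪x, c⟫ 1 := by
      have hx' : HasFDerivAt σ (innerSL ℝ x) ((1 : ℝ) • c) := by simpa using hx
      exact hx'.comp_hasDerivAt (1 : ℝ) hline
    have h2 : HasDerivAt (fun t : ℝ => σ (t • c)) (σ c) 1 := by
      have h3 : HasDerivAt (fun t : ℝ => t * σ c) (σ c) 1 := by
        simpa using (hasDerivAt_id (1 : ℝ)).mul_const (σ c)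
      refine h3.congr_of_eventuallyEq ?_
      filter_upwards [eventually_ge_nhds (zero_lt_one' ℝ)] with t ht using hhom t ht c
    exact h2.unique h1
  intro i
  refine exists_eq_intCast_of_forall_exists_abs_sub_lt fun ε hε => ?_
  -- Rounding `q • c` down moves it by at most `√d`; adding a unit vector costs at most `1` more.
  set M : ℝ := √d + 1 with hM
  have hMpos : 0 < M := by positivity
  have hη : 0 < ε / (4 * M) := by positivity
  obtain ⟨δ, hδ, hball⟩ := Metric.eventually_nhds_iff.1
    ((hasFDerivAt_iff_isLittleO.1 hx).def hη)
  obtain ⟨q, hq⟩ := exists_nat_gt (M / δ)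
  have hqpos : (0 : ℝ) < q := (div_pos hMpos hδ).trans hq
  have hMq : M < q * δ := by rwa [div_lt_iff₀ hδ] at hq
  -- By homogeneity, the linearization error near `q • c` is `q` times the error near `c`, over
  -- distances divided by `q`. The factors cancel, so the bound is independent of `q`.
  have key : ∀ p : EuclideanSpace ℝ (Fin d), ‖p - (q : ℝ) • c‖ ≤ M →
      |σ p - ⟪x, p⟫| ≤ ε / 4 := by
    intro p hp
    have hpq : (q : ℝ) • ((q : ℝ)⁻¹ • p) = p := smul_inv_smul₀ hqpos.ne' p
    have hnorm : (q : ℝ) * ‖(q : ℝ)⁻¹ • p - c‖ ≤ M := by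
      rw [← Real.norm_of_nonneg hqpos.le, ← norm_smul, smul_sub,
        Real.norm_of_nonneg hqpos.le, hpq]
      exact hp
    have hdist : dist ((q : ℝ)⁻¹ • p) c < δ := by
      rw [dist_eq_norm]
      by_contra hcon
      have := mul_le_mul_of_nonneg_left (not_lt.1 hcon) hqpos.le
      linarith
    have hb := hball hdist
    rw [innerSL_apply_apply, inner_sub_right, ← hc, Real.norm_eq_abs] at hb
    have heq : σ p - ⟪x, p⟫ =
        q * (σ ((q : ℝ)⁻¹ • p) - σ c - (⟪x, (q : ℝ)⁻¹ • p⟫ - σ c)) := by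
      have h1 := hhom q hqpos.le ((q : ℝ)⁻¹ • p)
      have h2 : ⟪x, (q : ℝ) • ((q : ℝ)⁻¹ • p)⟫ = q * ⟪x, (q : ℝ)⁻¹ • p⟫ :=
        real_inner_smul_right _ _ _
      rw [hpq] at h1 h2
      rw [h1, h2]
      ring
    rw [heq, abs_mul, abs_of_pos hqpos]
    calc _ ≤ q * (ε / (4 * M) * ‖(q : ℝ)⁻¹ • p - c‖) := by gcongr
      _ = ε / (4 * M) * (q * ‖(q : ℝ)⁻¹ • p - c‖) := by ring
      _ ≤ ε / (4 * M) * M := by gcongr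
      _ = ε / 4 := by field_simp
  set p : EuclideanSpace ℝ (Fin d) := WithLp.toLp 2 fun j => (⌊(q : ℝ) * c j⌋ : ℝ) with hp
  have hpint : IsIntegralVec p := fun j => ⟨_, rfl⟩
  have hp'int : IsIntegralVec (p + EuclideanSpace.single i 1) := fun j => by
    refine ⟨⌊(q : ℝ) * c j⌋ + if j = i then 1 else 0, ?_⟩
    simp [hp]
  have hpn : ‖p - (q : ℝ) • c‖ ≤ √d := by
    rw [EuclideanSpace.norm_eq]
    refine Real.sqrt_le_sqrt ((Finset.sum_le_card_nsmul _ _ 1 fun j _ => ?_).trans (by simp))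
    have h1 := Int.floor_le ((q : ℝ) * c j)
    have h2 := Int.lt_floor_add_one ((q : ℝ) * c j)
    simp only [hp, PiLp.sub_apply, PiLp.smul_apply, smul_eq_mul, Real.norm_eq_abs, sq_abs]
    nlinarith
  have hpn' : ‖p + EuclideanSpace.single i 1 - (q : ℝ) • c‖ ≤ M := by
    rw [add_sub_right_comm]
    refine (norm_add_le _ _).trans ?_
    simpa [hM] using hpn
  obtain ⟨z, hz⟩ := hint _ hpint
  obtain ⟨z', hz'⟩ := hint _ hp'int
  have h1 := key p (hpn.trans (by linarith))
  have h2 := key _ hpn'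
  rw [hz] at h1
  rw [hz', inner_add_right, EuclideanSpace.inner_single_right] at h2
  simp only [conj_trivial, one_mul] at h2
  -- The difference of `⟪x, ·⟫` between the two lattice points is `x i`, while that of `σ` is the
  -- integer `z' - z`; the two errors total at most `ε / 2`.
  refine ⟨z' - z, ?_⟩
  push_cast
  rw [abs_le] at h1 h2
  rw [abs_lt]
  constructor <;> linarith [h1.1, h1.2, h2.1, h2.2]

open scoped RealInnerProductSpace in
/-- A compact set whose support function takes integer values at integer vectors lies in its
integer hull. -/
theorem subset_integerHull_of_isCompact {d : ℕ} {C : Set (EuclideanSpace ℝ (Fin d))}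
    (hC : IsCompact C)
    (hint : ∀ c, IsIntegralVec c → ∀ x ∈ C, (∀ z ∈ C, ⟪c, z⟫ ≤ ⟪c, x⟫) → ∃ z : ℤ, ⟪c, x⟫ = z) :
    C ⊆ integerHull C := by
  intro x hxC
  have hmax : ∀ c : EuclideanSpace ℝ (Fin d), ∃ w ∈ C, ∀ z ∈ C, ⟪c, z⟫ ≤ ⟪c, w⟫ := fun c =>
    hC.exists_isMaxOn (f := fun z => ⟪c, z⟫) ⟨x, hxC⟩ (by fun_prop)
  choose w hwC hw using hmax
  set σ : EuclideanSpace ℝ (Fin d) → ℝ := fun c => ⟪c, w c⟫ with hσ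
  have hhom : ∀ t : ℝ, 0 ≤ t → ∀ c, σ (t • c) = t * σ c := by
    intro t ht c
    have h1 := hw (t • c) (w c) (hwC c)
    have h2 := mul_le_mul_of_nonneg_left (hw c (w (t • c)) (hwC _)) ht
    simp only [hσ, real_inner_smul_left] at h1 ⊢
    exact le_antisymm h2 h1
  obtain ⟨R, hR⟩ := hC.isBounded.exists_norm_le
  have hlip : LipschitzWith R.toNNReal σ := by
    refine LipschitzWith.of_le_add_mul _ fun c c' => ?_
    have h1 := hw c' (w c) (hwC c)
    have h2 : ⟪c - c', w c⟫ ≤ R * dist c c' := by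
      refine (real_inner_le_norm _ _).trans ?_
      rw [mul_comm, dist_eq_norm]
      exact mul_le_mul_of_nonneg_right (hR _ (hwC c)) (norm_nonneg _)
    rw [inner_sub_left] at h2
    rw [Real.coe_toNNReal R ((norm_nonneg x).trans (hR x hxC))]
    simp only [hσ]
    linarith
  have hfin := finite_setOf_isIntegralVec hC.isBounded
  by_contra hx
  obtain ⟨f, u, hfx, hfu⟩ := geometric_hahn_banach_point_closed (convex_convexHull ℝ _)
    (hfin.isClosed_convexHull ℝ) hx
  set U : Set (EuclideanSpace ℝ (Fin d)) :=
    {c | ∀ z ∈ {z | z ∈ C ∧ IsIntegralVec z}, ⟪c, z⟫ < ⟪c, x⟫} with hU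
  have hUo : IsOpen U := by
    have : U = ⋂ z ∈ {z | z ∈ C ∧ IsIntegralVec z}, {c | ⟪c, z⟫ < ⟪c, x⟫} := by
      ext c; simp [hU]
    rw [this]
    exact hfin.isOpen_biInter fun z _ => isOpen_lt (by fun_prop) (by fun_prop)
  have hUne : U.Nonempty := by
    refine ⟨-(InnerProductSpace.toDual ℝ _).symm f, fun z hz => ?_⟩
    rw [inner_neg_left, inner_neg_left, InnerProductSpace.toDual_symm_apply,
      InnerProductSpace.toDual_symm_apply]
    linarith [hfu z (subset_convexHull ℝ _ hz)]
  -- Rademacher's theorem: the points of differentiability are dense.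
  obtain ⟨c, hcU, hc⟩ := (MeasureTheory.Measure.dense_of_ae
    (hlip.ae_differentiableAt (μ := MeasureTheory.volume))).inter_open_nonempty U hUo hUne
  have hgrad : HasFDerivAt σ (innerSL ℝ (w c)) c := by
    have hd := (show DifferentiableAt ℝ σ c from hc).hasFDerivAt
    -- The linear function `⟪w c, ·⟫` supports `σ` from below and touches it at `c`, so the gradient
    -- must be `w c`.
    have hmin : IsLocalMin (fun v => σ v - innerSL ℝ (w c) v) c := by
      refine Filter.Eventually.of_forall fun v => ?_
      have := hw v (w c) (hwC c)
      simp only [hσ, innerSL_apply_apply, real_inner_comm c (w c), real_inner_comm v (w c)]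
      linarith
    have h0 := hmin.hasFDerivAt_eq_zero (hd.sub (innerSL ℝ (w c)).hasFDerivAt)
    rwa [sub_eq_zero.1 h0] at hd
  have hwint := isIntegralVec_of_hasFDerivAt hhom
    (fun v hv => hint v hv (w v) (hwC v) (hw v)) hgrad
  exact absurd (hw c x hxC) (not_le.2 (hcU (w c) ⟨hwC c, hwint⟩))

/-! ### The semidefinite cone and the feasible set -/

variable {n m : ℕ}

/-- The trace is the sum of the entries of the Hadamard product, i.e. its quadratic form at the
all-ones vector; apply the Schur product theorem. -/
theorem inner_nonneg_of_posSemidef {X S : symHat n}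
    (hX : (X : Matrix (Fin (n + 1)) (Fin (n + 1)) ℝ).PosSemidef)
    (hS : (S : Matrix (Fin (n + 1)) (Fin (n + 1)) ℝ).PosSemidef) : 0 ≤ inner ℝ X S := by
  change 0 ≤ ((X : Matrix (Fin (n + 1)) (Fin (n + 1)) ℝ) *
    (S : Matrix (Fin (n + 1)) (Fin (n + 1)) ℝ)ᵀ).trace
  rw [← Matrix.sum_hadamard_eq]
  simpa [dotProduct, Matrix.mulVec] using
    (hX.hadamard hS).dotProduct_mulVec_nonneg (fun _ => (1 : ℝ))

/-- The cone of positive semidefinite matrices contains the dual of the cone of positive definite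
matrices. -/
theorem posSemidef_of_forall_inner_nonneg {S : symHat n}
    (h : ∀ X : symHat n, (X : Matrix (Fin (n + 1)) (Fin (n + 1)) ℝ).PosDef → 0 ≤ inner ℝ S X) :
    (S : Matrix (Fin (n + 1)) (Fin (n + 1)) ℝ).PosSemidef := by
  have hSsymm : (S : Matrix (Fin (n + 1)) (Fin (n + 1)) ℝ).IsHermitian := by
    rw [Matrix.IsHermitian, Matrix.conjTranspose_eq_transpose_of_trivial]
    exact S.2
  refine Matrix.PosSemidef.of_dotProduct_mulVec_nonneg hSsymm fun v => ?_
  set T := (S : Matrix (Fin (n + 1)) (Fin (n + 1)) ℝ).trace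
  set r := star v ⬝ᵥ (S : Matrix (Fin (n + 1)) (Fin (n + 1)) ℝ) *ᵥ v with hr
  -- Test `S` against `vvᵀ + εI`, which is positive definite, and let `ε` tend to `0`.
  have key : ∀ ε : ℝ, 0 < ε → 0 ≤ r + ε * T := by
    intro ε hε
    have hpd : (Matrix.vecMulVec v v + ε • (1 : Matrix (Fin (n + 1)) (Fin (n + 1)) ℝ)).PosDef := by
      have h1 := Matrix.posSemidef_vecMulVec_self_star v
      rw [star_trivial] at h1
      exact Matrix.PosDef.posSemidef_add h1 (Matrix.PosDef.one.smul hε)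
    have hsymm : (Matrix.vecMulVec v v +
        ε • (1 : Matrix (Fin (n + 1)) (Fin (n + 1)) ℝ)).IsSymm := by
      have := hpd.isHermitian
      rwa [Matrix.IsHermitian, Matrix.conjTranspose_eq_transpose_of_trivial] at this
    have := h ⟨_, hsymm⟩ hpd
    change 0 ≤ ((S : Matrix (Fin (n + 1)) (Fin (n + 1)) ℝ) *
      (Matrix.vecMulVec v v + ε • (1 : Matrix (Fin (n + 1)) (Fin (n + 1)) ℝ))ᵀ).trace at this
    rw [hsymm.eq, mul_add, Matrix.trace_add, Matrix.mul_vecMulVec, Matrix.trace_vecMulVec,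
      mul_smul_comm, mul_one, Matrix.trace_smul, smul_eq_mul] at this
    rwa [hr, star_trivial, dotProduct_comm]
  by_contra hcon
  rw [not_le] at hcon
  have hε : 0 < -r / (|T| + 1) := div_pos (neg_pos.2 hcon) (by positivity)
  have h1 := key _ hε
  have h2 : -r / (|T| + 1) * (|T| + 1) = -r := div_mul_cancel₀ _ (by positivity)
  nlinarith [mul_le_mul_of_nonneg_left (le_abs_self T) hε.le]

/-- Positivity of the quadratic form need only be tested on the unit sphere, whose compactness makes
it stable under small perturbations. -/
theorem isOpen_setOf_posDef :
    IsOpen {X : symHat n | (X : Matrix (Fin (n + 1)) (Fin (n + 1)) ℝ).PosDef} := by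
  have hentry : ∀ i j, Continuous fun X : symHat n =>
      (X : Matrix (Fin (n + 1)) (Fin (n + 1)) ℝ) i j := fun i j =>
    LinearMap.continuous_of_finiteDimensional
      (((Matrix.entryLinearMap ℝ ℝ i j).comp (symHat n).subtype))
  have hcont : Continuous fun z : symHat n × (Fin (n + 1) → ℝ) =>
      z.2 ⬝ᵥ (z.1 : Matrix (Fin (n + 1)) (Fin (n + 1)) ℝ) *ᵥ z.2 := by
    simp only [dotProduct, Matrix.mulVec]
    refine continuous_finsetSum _ fun i _ => ?_
    refine ((continuous_apply i).comp continuous_snd).mul (continuous_finsetSum _ fun j _ => ?_)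
    exact ((hentry i j).comp continuous_fst).mul ((continuous_apply j).comp continuous_snd)
  rw [isOpen_iff_mem_nhds]
  intro X hX
  have hev : ∀ᶠ Y : symHat n in nhds X, ∀ v ∈ Metric.sphere (0 : Fin (n + 1) → ℝ) 1,
      0 < v ⬝ᵥ (Y : Matrix (Fin (n + 1)) (Fin (n + 1)) ℝ) *ᵥ v := by
    refine (isCompact_sphere 0 1).eventually_forall_of_forall_eventually fun v hv => ?_
    refine hcont.continuousAt.eventually_const_lt ?_
    simpa using hX.dotProduct_mulVec_pos (ne_zero_of_mem_unit_sphere (⟨v, hv⟩))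
  filter_upwards [hev] with Y hY
  refine Matrix.PosDef.of_dotProduct_mulVec_pos ?_ fun v hv => ?_
  · rw [Matrix.IsHermitian, Matrix.conjTranspose_eq_transpose_of_trivial]
    exact Y.2
  · have hv' : 0 < ‖v‖ := norm_pos_iff.2 hv
    have h1 := hY (‖v‖⁻¹ • v) (by simp [norm_smul, hv'.ne'])
    rw [Matrix.mulVec_smul, dotProduct_smul, smul_dotProduct, smul_eq_mul, smul_eq_mul,
      ← mul_assoc] at h1
    rw [star_trivial]
    exact pos_of_mul_pos_right h1 (by positivity)

theorem convex_setOf_forall_le (𝒜 : symHat n →ₗ[ℝ] EuclideanSpace ℝ (Fin m))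
    (b : EuclideanSpace ℝ (Fin m)) : Convex ℝ {X : symHat n | ∀ i, 𝒜 X i ≤ b i} := by
  intro X hX Y hY s t hs ht hst i
  have h1 := mul_le_mul_of_nonneg_left (hX i) hs
  have h2 := mul_le_mul_of_nonneg_left (hY i) ht
  simp only [map_add, map_smul, PiLp.add_apply, PiLp.smul_apply, smul_eq_mul]
  calc _ ≤ s * b i + t * b i := add_le_add h1 h2
    _ = b i := by rw [← add_mul, hst, one_mul]

theorem convex_feasibleSet (𝒜 : symHat n →ₗ[ℝ] EuclideanSpace ℝ (Fin m))
    (b : EuclideanSpace ℝ (Fin m)) : Convex ℝ (feasibleSet 𝒜 b) :=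
  fun _ hX _ hY _ _ hs ht hst => ⟨(hX.1.smul hs).add (hY.1.smul ht),
    convex_setOf_forall_le 𝒜 b hX.2 hY.2 hs ht hst⟩

/-! ### Conic duality -/

/-- Weak duality. -/
theorem inner_le_inner_of_isDualFeasible {𝒜 : symHat n →ₗ[ℝ] EuclideanSpace ℝ (Fin m)}
    {b : EuclideanSpace ℝ (Fin m)} {C X : symHat n} {y : EuclideanSpace ℝ (Fin m)}
    (hX : X ∈ feasibleSet 𝒜 b) (hy : IsDualFeasible 𝒜 C y) : inner ℝ C X ≤ inner ℝ b y := by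
  have h1 := inner_nonneg_of_posSemidef hX.1 hy.2
  rw [dualSlack, inner_sub_right, LinearMap.adjoint_inner_right] at h1
  have h2 : inner ℝ (𝒜 X) y ≤ inner ℝ b y := by
    simp only [PiLp.inner_apply]
    exact Finset.sum_le_sum fun i _ => by
      simpa using mul_le_mul_of_nonneg_left (hX.2 i) (hy.1 i)
  rw [real_inner_comm X C]
  linarith

/-- Separation of a convex set `Q` from an open convex cone `P` that it meets: a bound for `⟨c, x⟩`
over `P ∩ Q` extends to `Q` after adding to `c` an element of the dual cone of `P`. -/
theorem exists_mem_dual_forall_inner_add_le {E : Type*} [NormedAddCommGroup E]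
    [InnerProductSpace ℝ E] [CompleteSpace E] {P Q : Set E} (hPo : IsOpen P) (hP : Convex ℝ P)
    (hPsmul : ∀ x ∈ P, ∀ r : ℝ, 0 < r → r • x ∈ P) (hQ : Convex ℝ Q) (hPQ : (P ∩ Q).Nonempty)
    {c : E} {p : ℝ} (hp : ∀ x ∈ P ∩ Q, inner ℝ c x ≤ p) :
    ∃ s : E, (∀ x ∈ P, 0 ≤ inner ℝ s x) ∧ ∀ x ∈ Q, inner ℝ (c + s) x ≤ p := by
  obtain ⟨x₀, hx₀P, hx₀Q⟩ := hPQ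
  -- Separate `P × (p, ∞)` from the hypograph of `⟨c, ·⟩` over `Q`, in `E × ℝ`.
  obtain ⟨f, α, hf₁, hf₂⟩ := geometric_hahn_banach_open
    (s := P ×ˢ Set.Ioi p) (t := {z : E × ℝ | z.1 ∈ Q ∧ z.2 ≤ inner ℝ c z.1})
    (hP.prod (convex_Ioi p)) (hPo.prod isOpen_Ioi)
    (by
      rintro ⟨x, u⟩ ⟨hx, hu⟩ ⟨y, v⟩ ⟨hy, hv⟩ s t hs ht hst
      refine ⟨hQ hx hy hs ht hst, ?_⟩
      have h1 := mul_le_mul_of_nonneg_left hu hs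
      have h2 := mul_le_mul_of_nonneg_left hv ht
      simpa [inner_add_right, real_inner_smul_right] using add_le_add h1 h2)
    (by
      rw [Set.disjoint_left]
      rintro ⟨x, t⟩ ⟨hx, ht⟩ ⟨hxQ, htx⟩
      exact absurd (htx.trans (hp x ⟨hx, hxQ⟩)) (not_le.2 ht))
  set ℓ : StrongDual ℝ E := f.comp (ContinuousLinearMap.inl ℝ _ _) with hℓ
  set κ : ℝ := -f (0, 1) with hκ
  have hf : ∀ x t, f (x, t) = ℓ x - κ * t := by
    intro x t
    have : ((x, t) : E × ℝ) = (x, 0) + t • (0, 1) := by simp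
    rw [this, map_add, map_smul, smul_eq_mul]
    simp only [hℓ, hκ, ContinuousLinearMap.comp_apply, ContinuousLinearMap.inl_apply]
    ring
  have h₁ : ∀ x ∈ P, ∀ t, p < t → ℓ x - κ * t < α := fun x hx t ht => by
    rw [← hf]; exact hf₁ (x, t) ⟨hx, ht⟩
  have h₂ : ∀ x ∈ Q, α ≤ ℓ x - κ * inner ℝ c x := fun x hx => by
    rw [← hf]; exact hf₂ _ ⟨hx, le_rfl⟩
  -- The common point `x₀` excludes a vertical hyperplane.
  have hκpos : 0 < κ := by
    have h3 := h₁ x₀ hx₀P (p + 1) (by linarith)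
    have h4 := h₂ x₀ hx₀Q
    have h5 := hp x₀ ⟨hx₀P, hx₀Q⟩
    by_contra hcon
    nlinarith
  have hℓneg : ∀ x ∈ P, ℓ x ≤ 0 := by
    intro x hx
    by_contra hcon
    rw [not_le] at hcon
    have hr : 0 < (|α + κ * (p + 1)| + 1) / ℓ x := by positivity
    have := h₁ _ (hPsmul x hx _ hr) (p + 1) (by linarith)
    rw [map_smul, smul_eq_mul, div_mul_cancel₀ _ hcon.ne'] at this
    linarith [le_abs_self (α + κ * (p + 1))]
  -- This is the limit of `h₁` at `(r • x₀, p + r)` as `r → 0⁺`; the chosen `r` would give equality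
  -- in the strict inequality.
  have hα : 0 ≤ α + κ * p := by
    by_contra hcon
    rw [not_le] at hcon
    have hL : ℓ x₀ - κ < 0 := by linarith [hℓneg x₀ hx₀P]
    have hr : 0 < (α + κ * p) / (ℓ x₀ - κ) := div_pos_of_neg_of_neg hcon hL
    have h3 := h₁ _ (hPsmul x₀ hx₀P _ hr) (p + (α + κ * p) / (ℓ x₀ - κ)) (by linarith)
    rw [map_smul, smul_eq_mul] at h3
    have h4 : (α + κ * p) / (ℓ x₀ - κ) * (ℓ x₀ - κ) = α + κ * p := div_mul_cancel₀ _ hL.ne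
    linarith
  have hs : ∀ x, inner ℝ (-κ⁻¹ • (InnerProductSpace.toDual ℝ E).symm ℓ) x = -κ⁻¹ * ℓ x :=
    fun x => by rw [real_inner_smul_left, InnerProductSpace.toDual_symm_apply]
  refine ⟨-κ⁻¹ • (InnerProductSpace.toDual ℝ E).symm ℓ, fun x hx => ?_, fun x hx => ?_⟩
  · rw [hs]
    exact mul_nonneg_of_nonpos_of_nonpos (by simpa using hκpos.le) (hℓneg x hx)
  · rw [inner_add_left, hs]
    have h3 := h₂ x hx
    refine le_of_mul_le_mul_left ?_ hκpos
    have h4 : κ * (inner ℝ c x + -κ⁻¹ * ℓ x) = κ * inner ℝ c x - ℓ x := by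
      field_simp
      ring
    rw [h4]
    linarith

theorem convex_setOf_posDef :
    Convex ℝ {X : symHat n | (X : Matrix (Fin (n + 1)) (Fin (n + 1)) ℝ).PosDef} := by
  intro X hX Y hY s t hs ht hst
  rcases hs.eq_or_lt with rfl | hs
  · rw [zero_add] at hst
    simpa [hst] using hY
  · exact Matrix.PosDef.add_posSemidef (hX.smul hs) (hY.posSemidef.smul ht)

/-- Strong duality with dual attainment, under Slater's condition for the semidefinite
constraint. -/
theorem exists_isDualFeasible_inner_le {𝒜 : symHat n →ₗ[ℝ] EuclideanSpace ℝ (Fin m)}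
    {b : EuclideanSpace ℝ (Fin m)} {C : symHat n} {p : ℝ}
    (hpos : ∃ X ∈ feasibleSet 𝒜 b, (X : Matrix (Fin (n + 1)) (Fin (n + 1)) ℝ).PosDef)
    (hp : ∀ X ∈ feasibleSet 𝒜 b, inner ℝ C X ≤ p) :
    ∃ y, IsDualFeasible 𝒜 C y ∧ inner ℝ b y ≤ p := by
  obtain ⟨X₀, hX₀, hX₀pd⟩ := hpos
  -- Separation removes only the semidefinite constraint, at the price of `S`. The remaining problem
  -- is polyhedral, so Farkas applies without a strictly feasible point and yields `C + S = 𝒜*(y)`.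
  obtain ⟨S, hS, hSp⟩ := exists_mem_dual_forall_inner_add_le isOpen_setOf_posDef
    convex_setOf_posDef (fun X hX r hr => hX.smul hr) (convex_setOf_forall_le 𝒜 b)
    ⟨X₀, hX₀pd, hX₀.2⟩ (c := C) (p := p) fun X hX => hp X ⟨hX.1.posSemidef, hX.2⟩
  obtain ⟨y, hy, hCS, hby⟩ := exists_nonneg_combination_of_forall_le
    (fun i => (EuclideanSpace.projₗ i : EuclideanSpace ℝ (Fin m) →ₗ[ℝ] ℝ) ∘ₗ 𝒜) b
    (innerₗ (symHat n) (C + S)) p ⟨X₀, hX₀.2⟩ hSp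
  refine ⟨WithLp.toLp 2 y, ⟨hy, ?_⟩, ?_⟩
  · have : dualSlack 𝒜 C (WithLp.toLp 2 y) = S := by
      rw [dualSlack, sub_eq_iff_eq_add']
      refine ext_inner_right ℝ fun X => ?_
      have := LinearMap.congr_fun hCS X
      rw [LinearMap.adjoint_inner_left]
      simp only [innerₗ_apply_apply] at this
      rw [this]
      simp [PiLp.inner_apply, mul_comm]
    rw [this]
    exact posSemidef_of_forall_inner_nonneg hS
  · simpa [PiLp.inner_apply] using hby

end SemidefTDI

theorem theorem13 {n m k : ℕ}
    (𝒜 : SemidefTDI.symHat n →ₗ[ℝ] EuclideanSpace ℝ (Fin m))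
    (b : EuclideanSpace ℝ (Fin m))
    (ℒ : EuclideanSpace ℝ (Fin k) →ₗ[ℝ] SemidefTDI.symHat n)
    (hTDI : SemidefTDI.IsTDIThrough 𝒜 b ℒ)
    (hb : SemidefTDI.IsIntegralVec b)
    (hcompact : IsCompact (LinearMap.adjoint ℒ '' SemidefTDI.feasibleSet 𝒜 b))
    (hpos : ∃ X ∈ SemidefTDI.feasibleSet 𝒜 b,
      (X : Matrix (Fin (n + 1)) (Fin (n + 1)) ℝ).PosDef) :
    LinearMap.adjoint ℒ '' SemidefTDI.feasibleSet 𝒜 b =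
      SemidefTDI.integerHull (LinearMap.adjoint ℒ '' SemidefTDI.feasibleSet 𝒜 b) := by
  refine Set.Subset.antisymm (SemidefTDI.subset_integerHull_of_isCompact hcompact ?_)
    (convexHull_min (fun x hx => hx.1)
      ((SemidefTDI.convex_feasibleSet 𝒜 b).linear_image (LinearMap.adjoint ℒ)))
  rintro c hc _ ⟨X, hX, rfl⟩ hmax
  have hmax' : ∀ Z ∈ SemidefTDI.feasibleSet 𝒜 b, inner ℝ (ℒ c) Z ≤ inner ℝ (ℒ c) X := by
    intro Z hZ
    simpa only [LinearMap.adjoint_inner_right] using hmax _ ⟨Z, hZ, rfl⟩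
  obtain ⟨y₀, hy₀, hy₀X⟩ := SemidefTDI.exists_isDualFeasible_inner_le hpos hmax'
  -- By weak duality, `y₀` is optimal since its value does not exceed that of the feasible `X`.
  obtain ⟨y, hy, hyint, -⟩ := hTDI c hc ⟨y₀, hy₀, fun z hz =>
    hy₀X.trans (SemidefTDI.inner_le_inner_of_isDualFeasible hX hz)⟩
  have heq : inner ℝ (ℒ c) X = inner ℝ b y :=
    le_antisymm (SemidefTDI.inner_le_inner_of_isDualFeasible hX hy.1)
      ((hy.2 y₀ hy₀).trans hy₀X)
  choose β hβ using hb
  choose η hη using hyint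
  refine ⟨∑ i, η i * β i, ?_⟩
  rw [LinearMap.adjoint_inner_right, heq]
  simp [PiLp.inner_apply, hβ, hη]
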